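/- All graphs are finite and simple. A graph $G$ with $n\ge 1$ vertices is *recursively partitionable* (RP) if $G\simeq K_1$, or if $G$ is connected and, for every integer partition $a_1\le a_2\le\dots\le a_k$ of $n$ into $k\ge 2$ positive parts, there is a partition $\{A_1,\dots,A_k\}$ of $V(G)$ such that, for each $i$, $|A_i|=a_i$ and the induced subgraph $G[A_i]$ is RP. A set $S\subseteq V(G)$ is a *vertex cut* of $G$ if $G-S$ is disconnected, and $c(G-S)$ denotes the number of connected components of $G-S$. **Theorem.** Let $S$ be a vertex cut of a graph $G$ with $|S|\ge 2$. If $c(G-S)\ge 3|S|$, then $G$ is not RP. (Equivalently, if $G$ is RP and $S$ is a vertex cut of $G$ with $|S|\ge 2$, then $c(G-S)\le 3|S|-1$.) -/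

import Mathlib

universe u

namespace SimpleGraph

/-- A finite graph `G` of order `n` is recursively partitionable (RP) if `G ≃ K₁`, or `G` is
connected and for every integer partition `a₁ ≤ ⋯ ≤ aₖ` of `n` there is a partition
`{A₁, …, Aₖ}` of the vertex set with `|Aᵢ| = aᵢ` such that each induced subgraph `G[Aᵢ]` is RP.
The one-part partition `(n)`, for which the requirement would only say "`G` is RP" again, is left
out (`2 ≤ k`), so the recursion is on the order of the graph. -/
def IsRP {V : Type u} [Finite V] (G : SimpleGraph V) : Prop :=
  Nat.card V = 1 ∨
    (G.Connected ∧
      ∀ (k : ℕ) (a : Fin k → ℕ) (_ : 2 ≤ k) (_ : Monotone a) (_ : ∀ i, 0 < a i)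
        (_ : ∑ i, a i = Nat.card V),
        ∃ (A : Fin k → Set V) (_ : ∀ i, (A i).ncard = a i),
          (∀ v, ∃! i, v ∈ A i) ∧ ∀ i, IsRP (G.induce (A i)))
termination_by Nat.card V
decreasing_by
  rename_i hk _ hpos hsum hA
  rw [Nat.card_coe_set_eq, hA i, ← hsum]
  have : Nontrivial (Fin k) := Fin.nontrivial_iff_two_le.mpr hk
  obtain ⟨j, hj⟩ := exists_ne i
  exact Finset.single_lt_sum hj (Finset.mem_univ i) (Finset.mem_univ j) (hpos j)
    (fun _ _ _ => Nat.zero_le _)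

/-- The defining equation of `SimpleGraph.IsRP`. -/
theorem isRP_iff {V : Type u} [Finite V] (G : SimpleGraph V) :
    G.IsRP ↔ Nat.card V = 1 ∨
      (G.Connected ∧
        ∀ (k : ℕ) (a : Fin k → ℕ), 2 ≤ k → Monotone a → (∀ i, 0 < a i) →
          ∑ i, a i = Nat.card V →
          ∃ A : Fin k → Set V, (∀ i, (A i).ncard = a i) ∧
            (∀ v, ∃! i, v ∈ A i) ∧ ∀ i, (G.induce (A i)).IsRP) := by
  rw [IsRP]
  simp only [exists_prop]

/-- `S` is a vertex cut of `G`: the graph `G - S` is disconnected, i.e. it has two vertices with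
no path between them. -/
def IsVertexCut {V : Type u} (G : SimpleGraph V) (S : Set V) : Prop :=
  ¬ (G.induce Sᶜ).Preconnected

/-- `c(G)`, the number of connected components of `G`. -/
noncomputable def numComponents {V : Type u} (G : SimpleGraph V) : ℕ :=
  Nat.card G.ConnectedComponent

end SimpleGraph

namespace SimpleGraph

open Finset

/-! ### Transfer along isomorphisms and splits in two parts. -/

section RecursivelyPartitionable

/-! Colour the vertices outside `S` by their component of `G - S`; a connected set missing `S` is
monochromatic. Splits in two parts suffice. `IsRP.card_colours_le` bounds the colours of every RP
vertex set `U` with `s = #(U ∩ S)` positive: at most 3 if `s = 1`, fewer than `3 * s` if `s ≥ 2`.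

In a minimal counterexample, `exists_avoiding_split` gives part sizes that are not sizes of colour
classes. A part missing `S` then cannot exhaust its class, so the other part would be a smaller
counterexample. Hence both parts meet `S`, and the inductive bounds force `s = 2` and 3 + 3 colours.

This makes 1, 2, 3, 4, 6 class sizes, together with some `x`. A split 7 + 16 (if `x = 5`) or 5 + 14
(otherwise, when `x = 1` is forced) leaves an even part with one vertex of `S` and classes too small
for it to be halved. -/

/-- An embedding of graphs identifies the induced subgraph on a set with the induced subgraph on
its image. -/
noncomputable def Embedding.induceImage {V W : Type*} {G : SimpleGraph V} {H : SimpleGraph W}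
    (φ : G ↪g H) (A : Set V) : G.induce A ≃g H.induce (φ '' A) where
  toEquiv := Equiv.Set.image φ A φ.injective
  map_rel_iff' := by
    intro a b
    simp

theorem IsRP.of_iso {V W : Type u} [Finite V] [Finite W] {G : SimpleGraph V}
    {H : SimpleGraph W} (e : G ≃g H) (h : G.IsRP) : H.IsRP := by
  induction hn : Nat.card V using Nat.strong_induction_on generalizing V W with
  | _ n ih =>
    have hcard : Nat.card V = Nat.card W := Nat.card_congr e.toEquiv
    rw [isRP_iff] at h ⊢
    rcases h with h | ⟨hconn, h⟩
    · exact Or.inl (hcard ▸ h)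
    refine Or.inr ⟨e.connected_iff.mp hconn, fun k a hk hmono hpos hsum => ?_⟩
    obtain ⟨A, hA, hpart, hrp⟩ := h k a hk hmono hpos (hsum.trans hcard.symm)
    refine ⟨fun i => e '' A i, fun i => ?_, fun w => ?_, fun i => ?_⟩
    · rw [Set.ncard_image_of_injective _ e.injective, hA]
    · obtain ⟨i, hi, huniq⟩ := hpart (e.symm w)
      refine ⟨i, ⟨_, hi, by simp⟩, ?_⟩
      rintro j ⟨v, hv, rfl⟩
      exact huniq j (by simpa using hv)
    · refine ih (Nat.card (A i)) ?_ (e.toEmbedding.induceImage (A i)) (hrp i) rfl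
      rw [← hn, Nat.card_coe_set_eq, hA i, hcard, ← hsum]
      have : Nontrivial (Fin k) := Fin.nontrivial_iff_two_le.mpr hk
      obtain ⟨j, hj⟩ := exists_ne i
      exact Finset.single_lt_sum hj (Finset.mem_univ i) (Finset.mem_univ j) (hpos j)
        (fun _ _ _ => Nat.zero_le _)

theorem IsRP.connected {V : Type u} [Finite V] {G : SimpleGraph V} (h : G.IsRP) : G.Connected := by
  rw [isRP_iff] at h
  rcases h with h | ⟨h, -⟩
  · obtain ⟨_, _⟩ := Nat.card_eq_one_iff_unique.mp h
    exact Connected.of_subsingleton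
  · exact h

variable {V : Type u} [Finite V] [DecidableEq V] {G : SimpleGraph V}

/-- The vertex set of a recursively partitionable induced subgraph splits in two recursively
partitionable parts of any prescribed sizes. -/
theorem IsRP.exists_split_of_le {U : Finset V} (h : (G.induce (U : Set V)).IsRP) {a b : ℕ}
    (ha : 0 < a) (hab : a ≤ b) (hU : #U = a + b) :
    ∃ A B : Finset V, Disjoint A B ∧ A ∪ B = U ∧ #A = a ∧ #B = b ∧
      (G.induce (A : Set V)).IsRP ∧ (G.induce (B : Set V)).IsRP := by
  classical
  have hcard : Nat.card (U : Set V) = a + b := by simp [hU]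
  rw [isRP_iff] at h
  rcases h with h | ⟨-, h⟩
  · omega
  obtain ⟨A, hA, hpart, hrp⟩ := h 2 ![a, b] le_rfl
    (by
      intro i j hij
      fin_cases i <;> fin_cases j <;> simp_all)
    (by
      intro i
      fin_cases i <;> simp <;> omega)
    (by rw [hcard]; simp)
  let B : Fin 2 → Finset V := fun i => (Set.toFinite (Subtype.val '' A i)).toFinset
  have hB (i) : (B i : Set V) = Subtype.val '' A i := by simp [B]
  have hBcard (i) : #(B i) = (![a, b] : Fin 2 → ℕ) i := by
    rw [← hA i, ← Set.ncard_image_of_injective _ Subtype.val_injective, ← hB,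
      Set.ncard_coe_finset]
  have hBrp (i) : (G.induce (B i : Set V)).IsRP := by
    rw [hB]
    exact IsRP.of_iso ((Embedding.induce (G := G) (U : Set V)).induceImage (A i)) (hrp i)
  have hmem (i v) : v ∈ B i ↔ ∃ hv : v ∈ U, (⟨v, hv⟩ : (U : Set V)) ∈ A i := by
    rw [← Finset.mem_coe, hB]
    simp
  refine ⟨B 0, B 1, ?_, ?_, hBcard 0, hBcard 1, hBrp 0, hBrp 1⟩
  · rw [Finset.disjoint_left]
    intro v h0 h1
    obtain ⟨hv, h0⟩ := (hmem 0 v).mp h0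
    obtain ⟨_, h1⟩ := (hmem 1 v).mp h1
    exact absurd ((hpart ⟨v, hv⟩).unique h0 h1) (by decide)
  · ext v
    rw [Finset.mem_union, hmem, hmem]
    constructor
    · rintro (⟨hv, -⟩ | ⟨hv, -⟩) <;> exact hv
    · intro hv
      obtain ⟨i, hi, -⟩ := hpart ⟨v, hv⟩
      fin_cases i
      · exact Or.inl ⟨hv, hi⟩
      · exact Or.inr ⟨hv, hi⟩

theorem IsRP.exists_split {U : Finset V} (h : (G.induce (U : Set V)).IsRP) {a b : ℕ}
    (ha : 0 < a) (hb : 0 < b) (hU : #U = a + b) :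
    ∃ A B : Finset V, Disjoint A B ∧ A ∪ B = U ∧ #A = a ∧ #B = b ∧
      (G.induce (A : Set V)).IsRP ∧ (G.induce (B : Set V)).IsRP := by
  rcases le_total a b with hab | hab
  · exact h.exists_split_of_le ha hab hU
  · obtain ⟨A, B, h1, h2, h3, h4, h5, h6⟩ := h.exists_split_of_le hb hab (by omega)
    exact ⟨B, A, h1.symm, by rw [union_comm, h2], h4, h3, h6, h5⟩

end RecursivelyPartitionable

/-! ### Arithmetic of the class sizes. -/

/-- If at least `4` positive integers have sum `n - 1`, or at least `6` have sum at most `n - 2`,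
then some `a` with `0 < a < n` is such that neither `a` nor `n - a` is among them. -/
theorem exists_avoiding_split {ι : Type*} [DecidableEq ι] (T : Finset ι) (d : ι → ℕ)
    (hd : ∀ i ∈ T, 0 < d i) {n s : ℕ} (hn : n = s + ∑ i ∈ T, d i)
    (h : s = 1 ∧ 4 ≤ #T ∨ 2 ≤ s ∧ 6 ≤ #T) :
    ∃ a b, 0 < a ∧ 0 < b ∧ n = a + b ∧ ∀ i ∈ T, d i ≠ a ∧ d i ≠ b := by
  by_contra hcon
  push Not at hcon
  have key : ∀ a ∈ Icc 1 (n / 2), ∃ i ∈ T, d i = a ∨ d i = n - a := by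
    intro a ha
    rw [mem_Icc] at ha
    obtain ⟨i, hi, h'⟩ := hcon a (n - a) (by omega) (by omega) (by omega)
    exact ⟨i, hi, or_iff_not_imp_left.mpr h'⟩
  have : Nonempty ι := by
    obtain ⟨i, -⟩ := card_pos.mp (by omega : 0 < #T)
    exact ⟨i⟩
  choose! g hgT hg using key
  -- Two values of `a` up to `n / 2` sharing an index are equal or have sum `n`, so are equal
  -- anyway.
  have hinj : Set.InjOn g ((Icc 1 (n / 2) : Finset ℕ) : Set ℕ) := by
    intro a ha b hb hab
    have h1 := hg a ha
    have h2 := hg b hb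
    rw [← hab] at h2
    rw [mem_coe, mem_Icc] at ha hb
    omega
  have himg : (Icc 1 (n / 2)).image g ⊆ T := by
    intro i hi
    obtain ⟨a, ha, rfl⟩ := mem_image.mp hi
    exact hgT a ha
  have hcard : #((Icc 1 (n / 2)).image g) = n / 2 := by
    rw [card_image_of_injOn hinj]
    simp
  have hcard' := card_sdiff_add_card_eq_card himg
  have hsum : ∑ a ∈ Icc 1 (n / 2), a ≤ ∑ i ∈ (Icc 1 (n / 2)).image g, d i := by
    rw [sum_image hinj]
    refine sum_le_sum fun a ha => ?_
    have := hg a ha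
    rw [mem_Icc] at ha
    omega
  have hgauss : (∑ a ∈ Icc 1 (n / 2), a) * 2 = n / 2 * (n / 2 + 1) := by
    induction n / 2 with
    | zero => rfl
    | succ m ih =>
      rw [sum_Icc_succ_top (by omega), add_mul, ih]
      ring
  have hrest : #(T \ (Icc 1 (n / 2)).image g) ≤ ∑ i ∈ T \ (Icc 1 (n / 2)).image g, d i := by
    rw [card_eq_sum_ones]
    exact sum_le_sum fun i hi => hd i (sdiff_subset hi)
  have htot := sum_sdiff (f := d) himg
  have hm : n ≤ 2 * (n / 2) + 1 := by omega
  -- The chosen indices contribute at least `m * (m + 1) / 2` and the others at least 1 each,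
  -- against `n ≤ 2 * m + 1`. For `m ≥ 4` the first term alone is too large.
  generalize n / 2 = m at *
  have hm4 : m < 4 := by
    by_contra! h4
    have : m * 5 ≤ m * (m + 1) := Nat.mul_le_mul_left _ (by omega)
    omega
  interval_cases m <;> omega

/-- If six integers include `1`, `2`, `3`, `4`, `6`, the remaining one `d x` determines their sum, and
it is `1` if some three of them are positive with sum `4`. -/
theorem exists_sixth {ι : Type*} [DecidableEq ι] {T : Finset ι} (hT : #T = 6) {d : ι → ℕ}
    (h : ∀ a ∈ ({1, 2, 3, 4, 6} : Finset ℕ), ∃ i ∈ T, d i = a) :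
    ∃ x ∈ T, (∀ i ∈ T, i ≠ x → d i ≤ 6 ∧ d i ≠ 5) ∧ ∑ i ∈ T, d i = 16 + d x ∧
      ∀ R ⊆ T, #R = 3 → ∑ i ∈ R, d i = 4 → (∀ i ∈ R, 0 < d i) → d x = 1 := by
  obtain ⟨i₁, m₁, h₁⟩ := h 1 (by simp)
  obtain ⟨i₂, m₂, h₂⟩ := h 2 (by simp)
  obtain ⟨i₃, m₃, h₃⟩ := h 3 (by simp)
  obtain ⟨i₄, m₄, h₄⟩ := h 4 (by simp)
  obtain ⟨i₆, m₆, h₆⟩ := h 6 (by simp)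
  have ne {i j : ι} (hij : d i ≠ d j) : i ≠ j := fun h => hij (congrArg d h)
  have n12 : i₁ ≠ i₂ := ne (by omega)
  have n13 : i₁ ≠ i₃ := ne (by omega)
  have n14 : i₁ ≠ i₄ := ne (by omega)
  have n16 : i₁ ≠ i₆ := ne (by omega)
  have n23 : i₂ ≠ i₃ := ne (by omega)
  have n24 : i₂ ≠ i₄ := ne (by omega)
  have n26 : i₂ ≠ i₆ := ne (by omega)
  have n34 : i₃ ≠ i₄ := ne (by omega)
  have n36 : i₃ ≠ i₆ := ne (by omega)
  have n46 : i₄ ≠ i₆ := ne (by omega)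
  have hsub : ({i₁, i₂, i₃, i₄, i₆} : Finset ι) ⊆ T := by
    simp [insert_subset_iff, *]
  have hcard : #({i₁, i₂, i₃, i₄, i₆} : Finset ι) = 5 := by
    simp [*]
  obtain ⟨x, hxT, hx⟩ := exists_mem_notMem_of_card_lt_card (by omega :
    #({i₁, i₂, i₃, i₄, i₆} : Finset ι) < #T)
  have hTeq : insert x ({i₁, i₂, i₃, i₄, i₆} : Finset ι) = T := by
    refine eq_of_subset_of_card_le (insert_subset hxT hsub) ?_
    rw [card_insert_of_notMem hx]
    omega
  refine ⟨x, hxT, ?_, ?_, ?_⟩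
  · intro i hi hix
    rw [← hTeq] at hi
    simp only [mem_insert, mem_singleton, hix, false_or] at hi
    rcases hi with rfl | rfl | rfl | rfl | rfl <;> omega
  · rw [← hTeq, sum_insert hx]
    simp [sum_insert, *]
    omega
  · intro R hRT hR hsum hpos
    have hle : ∀ i ∈ R, d i ≤ 2 := by
      intro i hi
      rw [← add_sum_erase _ _ hi] at hsum
      have h3 : #(R.erase i) ≤ ∑ k ∈ R.erase i, d k := by
        rw [card_eq_sum_ones]
        exact sum_le_sum fun k hk => hpos k (mem_of_mem_erase hk)
      rw [card_erase_of_mem hi] at h3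
      omega
    -- Terms at most 2 exclude the indices of 3, 4 and 6.
    have hsub' : R ⊆ {x, i₁, i₂} := by
      intro i hi
      have h2 := hle i hi
      have hiT := hRT hi
      rw [← hTeq] at hiT
      simp only [mem_insert, mem_singleton] at hiT ⊢
      rcases hiT with rfl | rfl | rfl | rfl | rfl | rfl <;> first | tauto | omega
    have hReq : R = {x, i₁, i₂} :=
      eq_of_subset_of_card_le hsub' (card_le_three.trans hR.ge)
    simp only [mem_insert, mem_singleton, not_or] at hx
    rw [hReq, sum_insert (by simp [hx]), sum_pair n12] at hsum
    omega

/-! ### Colour classes outside the cut. -/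

section Colouring

variable {V : Type u} [DecidableEq V] {ι : Type*} [DecidableEq ι] (S : Finset V) (f : V → ι)

/-- The colours of the vertices of `U` outside `S`. -/
def colours (U : Finset V) : Finset ι := (U \ S).image f

/-- The number of vertices of `U` outside `S` of a given colour. -/
def colourSize (U : Finset V) (i : ι) : ℕ := #{v ∈ U \ S | f v = i}

variable {S f}

theorem card_eq_card_inter_add_sum_colourSize (U : Finset V) :
    #U = #(U ∩ S) + ∑ i ∈ colours S f U, colourSize S f U i := by
  rw [← card_inter_add_card_sdiff U S, card_eq_sum_card_image f (U \ S)]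
  rfl

theorem colourSize_pos {U : Finset V} {i : ι} : 0 < colourSize S f U i ↔ i ∈ colours S f U := by
  simp [colourSize, colours, card_pos, Finset.Nonempty]

theorem colourSize_mono {A U : Finset V} (h : A ⊆ U) (i : ι) :
    colourSize S f A i ≤ colourSize S f U i :=
  card_le_card (filter_subset_filter _ (sdiff_subset_sdiff h le_rfl))

theorem colourSize_union {A B : Finset V} (h : Disjoint A B) (i : ι) :
    colourSize S f (A ∪ B) i = colourSize S f A i + colourSize S f B i := by
  unfold colourSize
  rw [union_sdiff_distrib, filter_union, card_union_of_disjoint]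
  exact disjoint_filter_filter (h.mono sdiff_subset sdiff_subset)

theorem colours_union (A B : Finset V) :
    colours S f (A ∪ B) = colours S f A ∪ colours S f B := by
  unfold colours
  rw [union_sdiff_distrib, image_union]

theorem card_union_inter {A B : Finset V} (h : Disjoint A B) :
    #((A ∪ B) ∩ S) = #(A ∩ S) + #(B ∩ S) := by
  rw [union_inter_distrib_right, card_union_of_disjoint]
  exact h.mono inter_subset_left inter_subset_left

/-- Each other colour takes up at least one vertex. -/
theorem colourSize_add_card_colours_le (U : Finset V) {i : ι} (hi : i ∈ colours S f U) :
    colourSize S f U i + #(colours S f U) + #(U ∩ S) ≤ #U + 1 := by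
  have h1 := card_eq_card_inter_add_sum_colourSize (S := S) (f := f) U
  rw [← add_sum_erase _ _ hi] at h1
  have h2 : #((colours S f U).erase i) ≤ ∑ j ∈ (colours S f U).erase i, colourSize S f U j := by
    rw [card_eq_sum_ones]
    exact sum_le_sum fun j hj => colourSize_pos.mpr (mem_of_mem_erase hj)
  rw [card_erase_of_mem hi] at h2
  omega

variable [Finite V] {G : SimpleGraph V}

/-- A recursively partitionable set disjoint from `S` is monochromatic if adjacent vertices outside
`S` have the same colour. -/
theorem IsRP.exists_colour (hf : ∀ u v, G.Adj u v → u ∉ S → v ∉ S → f u = f v)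
    {B : Finset V} (hB : (G.induce (B : Set V)).IsRP) (hS : #(B ∩ S) = 0) :
    ∃ i, colourSize S f B i = #B ∧ colours S f B = {i} := by
  have hdisj : ∀ v ∈ B, v ∉ S := by
    rw [card_eq_zero, ← disjoint_iff_inter_eq_empty] at hS
    exact fun v hv hvS => Finset.disjoint_left.mp hS hv hvS
  have hsdiff : B \ S = B := sdiff_eq_self_of_disjoint (Finset.disjoint_left.mpr hdisj)
  obtain ⟨⟨x, hx⟩⟩ := hB.connected.nonempty
  have hcol : ∀ v ∈ B, f v = f x := by
    intro v hv
    obtain ⟨p⟩ := hB.connected.preconnected ⟨v, hv⟩ ⟨x, hx⟩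
    have : ∀ (a b : (B : Set V)), (G.induce (B : Set V)).Walk a b → f a = f b := by
      intro a b p
      induction p with
      | nil => rfl
      | @cons a b c hab _ ih => exact (hf _ _ hab (hdisj _ a.2) (hdisj _ b.2)).trans ih
    exact this _ _ p
  refine ⟨f x, ?_, ?_⟩
  · rw [colourSize, hsdiff, filter_true_of_mem hcol]
  · rw [colours, hsdiff]
    ext i
    simp only [mem_image, mem_singleton]
    exact ⟨fun ⟨v, hv, h⟩ => h ▸ hcol v hv, fun h => ⟨x, hx, h.symm⟩⟩

/-- Removing a part disjoint from `S` whose size is not the size of a colour class keeps all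
colours. -/
theorem IsRP.colours_eq_of_disjoint (hf : ∀ u v, G.Adj u v → u ∉ S → v ∉ S → f u = f v)
    {A B : Finset V} (hB : (G.induce (B : Set V)).IsRP) (hS : #(B ∩ S) = 0) (hAB : Disjoint A B)
    (hsize : ∀ i ∈ colours S f (A ∪ B), colourSize S f (A ∪ B) i ≠ #B) :
    colours S f A = colours S f (A ∪ B) := by
  obtain ⟨i, hi, hcol⟩ := hB.exists_colour hf hS
  have hmem : i ∈ colours S f (A ∪ B) := by simp [colours_union, hcol]
  have := hsize i hmem
  rw [colourSize_union hAB, hi] at this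
  have hiA : i ∈ colours S f A := by
    rw [← colourSize_pos]
    omega
  rw [colours_union, hcol]
  exact (union_eq_left.mpr (singleton_subset_iff.mpr hiA)).symm

/-- If a set of order `2 * h` meets `S` in one vertex and all its colour classes have fewer than `h`
vertices, it has no partition in two connected parts of order `h`. -/
theorem not_isRP_of_colourSize_lt_half (hf : ∀ u v, G.Adj u v → u ∉ S → v ∉ S → f u = f v)
    {U : Finset V} (hS : #(U ∩ S) = 1) {h : ℕ} (hU : #U = 2 * h)
    (hlt : ∀ i, colourSize S f U i < h) : ¬ (G.induce (U : Set V)).IsRP := by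
  intro hrp
  have hpos : 0 < h := by
    have := card_le_card (inter_subset_left (s₁ := U) (s₂ := S))
    omega
  obtain ⟨A, B, hAB, rfl, hA, hB, hArp, hBrp⟩ := hrp.exists_split hpos hpos (by omega)
  rw [card_union_inter hAB] at hS
  obtain h0 | h0 : #(A ∩ S) = 0 ∨ #(B ∩ S) = 0 := by omega
  · obtain ⟨i, hi, -⟩ := hArp.exists_colour hf h0
    have := hlt i
    rw [colourSize_union hAB] at this
    omega
  · obtain ⟨i, hi, -⟩ := hBrp.exists_colour hf h0
    have := hlt i
    rw [colourSize_union hAB] at this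
    omega

/-- All three classes are singletons, so no 2 + 2 split exists. -/
theorem not_isRP_of_card_eq_four (hf : ∀ u v, G.Adj u v → u ∉ S → v ∉ S → f u = f v)
    {U : Finset V} (hS : #(U ∩ S) = 1) (hU : #U = 4) (hc : #(colours S f U) = 3) :
    ¬ (G.induce (U : Set V)).IsRP := by
  refine not_isRP_of_colourSize_lt_half hf hS (h := 2) hU fun i => ?_
  by_cases hi : i ∈ colours S f U
  · have := colourSize_add_card_colours_le U hi
    omega
  · rw [← colourSize_pos] at hi
    omega

/-- Classes 2, 2, 1 rule out a 3 + 3 split. Classes 3, 1, 1 rule out 4 + 2: the 4 must contain the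
vertex of `S` and keeps all three colours. -/
theorem not_isRP_of_card_eq_six (hf : ∀ u v, G.Adj u v → u ∉ S → v ∉ S → f u = f v)
    {U : Finset V} (hS : #(U ∩ S) = 1) (hU : #U = 6) (hc : #(colours S f U) = 3) :
    ¬ (G.induce (U : Set V)).IsRP := by
  by_cases hlt : ∀ i, colourSize S f U i < 3
  · exact not_isRP_of_colourSize_lt_half hf hS (h := 3) hU hlt
  push Not at hlt
  obtain ⟨j, hj⟩ := hlt
  have hle : ∀ i ∈ colours S f U, colourSize S f U i ≤ 3 := by
    intro i hi
    have := colourSize_add_card_colours_le U hi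
    omega
  have hne : ∀ i ∈ colours S f U, colourSize S f U i ≠ 2 := by
    intro i hi h2
    have hjU : j ∈ colours S f U := colourSize_pos.mp (by omega)
    have hij : i ≠ j := by
      rintro rfl
      omega
    have h1 := card_eq_card_inter_add_sum_colourSize (S := S) (f := f) U
    rw [← add_sum_erase _ _ hjU,
      ← add_sum_erase _ _ (mem_erase.mpr ⟨hij, hi⟩)] at h1
    have h3 : #(((colours S f U).erase j).erase i) ≤
        ∑ k ∈ ((colours S f U).erase j).erase i, colourSize S f U k := by
      rw [card_eq_sum_ones]
      exact sum_le_sum fun k hk => colourSize_pos.mpr (mem_of_mem_erase (mem_of_mem_erase hk))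
    rw [card_erase_of_mem (mem_erase.mpr ⟨hij, hi⟩), card_erase_of_mem hjU] at h3
    omega
  intro hrp
  obtain ⟨A, B, hAB, rfl, hA, hB, hArp, hBrp⟩ :=
    hrp.exists_split (a := 4) (b := 2) (by omega) (by omega) (by omega)
  rw [card_union_inter hAB] at hS
  obtain h0 | h0 : #(A ∩ S) = 0 ∨ #(B ∩ S) = 0 := by omega
  · obtain ⟨i, hi, hcol⟩ := hArp.exists_colour hf h0
    have := hle i (by simp [colours_union, hcol])
    rw [colourSize_union hAB] at this
    omega
  · refine not_isRP_of_card_eq_four hf (U := A) (by omega) hA ?_ hArp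
    rw [hBrp.colours_eq_of_disjoint hf h0 hAB (by rwa [hB]), hc]

/-! ### The induction on the order. -/

/-- A recursively partitionable set that meets `S` has at most `3` colours outside `S` if it
contains one vertex of `S`, and fewer than `3 * s` colours if it contains `s ≥ 2` of them. -/
theorem IsRP.card_colours_le (hf : ∀ u v, G.Adj u v → u ∉ S → v ∉ S → f u = f v)
    {U : Finset V} (hU : (G.induce (U : Set V)).IsRP) :
    (#(U ∩ S) = 1 → #(colours S f U) ≤ 3) ∧
      (2 ≤ #(U ∩ S) → #(colours S f U) < 3 * #(U ∩ S)) := by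
  induction hn : #U using Nat.strong_induction_on generalizing U with
  | _ n ih =>
  subst hn
  have hpos : ∀ i ∈ colours S f U, 0 < colourSize S f U i := fun i hi => colourSize_pos.mpr hi
  have hsum := card_eq_card_inter_add_sum_colourSize (S := S) (f := f) U
  by_contra hcon
  have hmany : #(U ∩ S) = 1 ∧ 4 ≤ #(colours S f U) ∨
      2 ≤ #(U ∩ S) ∧ 3 * #(U ∩ S) ≤ #(colours S f U) := by
    by_contra h
    exact hcon ⟨fun _ => by omega, fun _ => by omega⟩
  have split : ∀ a b, 0 < a → 0 < b → #U = a + b →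
      (∀ i ∈ colours S f U, colourSize S f U i ≠ a ∧ colourSize S f U i ≠ b) →
      ∃ A B : Finset V, Disjoint A B ∧ A ∪ B = U ∧ #A = a ∧ #B = b ∧
        (G.induce (A : Set V)).IsRP ∧ (G.induce (B : Set V)).IsRP ∧
        #(A ∩ S) = 1 ∧ #(B ∩ S) = 1 ∧ #(U ∩ S) = 2 ∧ #(colours S f U) = 6 ∧
        #(colours S f A) = 3 ∧ #(colours S f B) = 3 := by
    intro a b ha hb hab hne
    obtain ⟨A, B, hAB, rfl, hA, hB, hArp, hBrp⟩ := hU.exists_split ha hb hab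
    have hA' := ih #A (by omega) hArp rfl
    have hB' := ih #B (by omega) hBrp rfl
    rw [card_union_inter hAB] at hmany
    by_cases h0 : #(A ∩ S) = 0
    · rw [union_comm, ← hArp.colours_eq_of_disjoint hf h0 hAB.symm
        (by rw [union_comm, hA]; exact fun i hi => (hne i hi).1)] at hmany
      omega
    by_cases h1 : #(B ∩ S) = 0
    · rw [← hBrp.colours_eq_of_disjoint hf h1 hAB
        (by rw [hB]; exact fun i hi => (hne i hi).2)] at hmany
      omega
    have hle := card_union_le (colours S f A) (colours S f B)
    rw [← colours_union] at hle
    refine ⟨A, B, hAB, rfl, hA, hB, hArp, hBrp, ?_⟩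
    rw [card_union_inter hAB]
    omega
  obtain ⟨a, b, ha, hb, hab, hne⟩ := exists_avoiding_split (colours S f U) (colourSize S f U)
    hpos hsum (by omega)
  obtain ⟨-, -, -, -, -, -, -, -, -, -, hs, hc, -⟩ := split a b ha hb hab hne
  -- Five other colours and two vertices of `S` lie outside the class. So `#U - a` with `a ≤ 6` is
  -- never a class size.
  have hle : ∀ i ∈ colours S f U, colourSize S f U i + 7 ≤ #U := by
    intro i hi
    have := colourSize_add_card_colours_le U hi
    omega
  have hcardU : 8 ≤ #U := by
    have : #(colours S f U) ≤ ∑ i ∈ colours S f U, colourSize S f U i := by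
      rw [card_eq_sum_ones]
      exact sum_le_sum hpos
    omega
  have hsizes : ∀ a ∈ ({1, 2, 3, 4, 6} : Finset ℕ), ∃ i ∈ colours S f U,
      colourSize S f U i = a := by
    intro a ha
    have ha' : a = 1 ∨ a = 2 ∨ a = 3 ∨ a = 4 ∨ a = 6 := by simpa using ha
    by_contra! hno
    obtain ⟨A, B, -, -, hA, -, hArp, -, hAS, -, -, -, hAc, -⟩ := split a (#U - a) (by omega) (by omega)
      (by omega) (fun i hi => ⟨hno i hi, by have := hle i hi; omega⟩)
    have hAsum := card_eq_card_inter_add_sum_colourSize (S := S) (f := f) A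
    have : #(colours S f A) ≤ ∑ i ∈ colours S f A, colourSize S f A i := by
      rw [card_eq_sum_ones]
      exact sum_le_sum fun i hi => colourSize_pos.mpr hi
    -- Three colours and a vertex of `S` need `a ≥ 4`.
    obtain h4 | h6 : a = 4 ∨ a = 6 := by omega
    · exact not_isRP_of_card_eq_four hf hAS (hA.trans h4) hAc hArp
    · exact not_isRP_of_card_eq_six hf hAS (hA.trans h6) hAc hArp
  obtain ⟨x, hx, hx6, hxsum, hxone⟩ := exists_sixth hc hsizes
  have hsmall (hx5 : colourSize S f U x ≤ 5) (i : ι) : colourSize S f U i ≤ 6 := by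
    by_cases hi : i ∈ colours S f U
    · by_cases hix : i = x
      · rw [hix]
        omega
      · exact (hx6 i hi hix).1
    · rw [← colourSize_pos] at hi
      omega
  by_cases h5 : ∃ i ∈ colours S f U, colourSize S f U i = 5
  · obtain ⟨i, hi, hi5⟩ := h5
    have hix : i = x := by
      by_contra hix
      exact (hx6 i hi hix).2 hi5
    subst hix
    -- Here `#U = 2 + 16 + 5 = 23` and no class exceeds 6.
    obtain ⟨A, B, hAB, hABU, hA, hB, hArp, hBrp, hAS, hBS, -⟩ :=
      split 7 16 (by omega) (by omega) (by omega) (fun j _ => by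
        have := hsmall hi5.le j
        omega)
    refine not_isRP_of_colourSize_lt_half hf hBS (h := 8) (by omega) (fun j => ?_) hBrp
    have h1 := hsmall hi5.le j
    have h2 := colourSize_mono (S := S) (f := f) (hABU ▸ subset_union_right : B ⊆ U) j
    omega
  · push Not at h5
    obtain ⟨A, B, hAB, hABU, hA, hB, hArp, hBrp, hAS, hBS, -, -, hAc, hBc⟩ :=
      split 5 (#U - 5) (by omega) (by omega)
      (by omega) (fun i hi => ⟨h5 i hi, by have := hle i hi; omega⟩)
    have hAsum := card_eq_card_inter_add_sum_colourSize (S := S) (f := f) A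
    have hcup : colours S f U = colours S f A ∪ colours S f B := by rw [← hABU, colours_union]
    -- As 3 + 3 = 6, the parts share no colour, so `A` contains three whole classes of total size 4.
    -- This forces `x` to have size 1, whence `#U = 19` and `#B = 14`.
    have hdisj : Disjoint (colours S f A) (colours S f B) := by
      rw [← card_union_eq_card_add_card, ← hcup]
      omega
    have heq : ∀ i ∈ colours S f A, colourSize S f U i = colourSize S f A i := by
      intro i hi
      have := Finset.disjoint_left.mp hdisj hi
      rw [← colourSize_pos] at this
      rw [← hABU, colourSize_union hAB]
      omega
    have hA4 : ∑ i ∈ colours S f A, colourSize S f A i = 4 := by omega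
    have hx1 := hxone (colours S f A) (hcup ▸ subset_union_left) hAc
      ((sum_congr rfl heq).trans hA4)
      (fun i hi => hpos i (hcup ▸ mem_union_left _ hi))
    refine not_isRP_of_colourSize_lt_half hf hBS (h := 7) (by omega) (fun i => ?_) hBrp
    have h1 := hsmall (by omega) i
    have h2 := colourSize_mono (S := S) (f := f) (hABU ▸ subset_union_right : B ⊆ U) i
    omega

end Colouring

end SimpleGraph

theorem theorem7p1 {V : Type*} [Finite V] (G : SimpleGraph V) (S : Set V)
    (hcut : G.IsVertexCut S) (hS : 2 ≤ S.ncard)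
    (hc : 3 * S.ncard ≤ (G.induce Sᶜ).numComponents) :
    ¬ G.IsRP := by
  classical
  intro hrp
  have := Fintype.ofFinite V
  let T : Finset V := S.toFinset
  -- The value `none` on `S` is never counted, since `colours` discards `S`.
  let f : V → Option (G.induce Sᶜ).ConnectedComponent := fun v =>
    if h : v ∈ Sᶜ then some ((G.induce Sᶜ).connectedComponentMk ⟨v, h⟩) else none
  have hf : ∀ u v, G.Adj u v → u ∉ T → v ∉ T → f u = f v := by
    intro u v huv hu hv
    have hu' : u ∈ Sᶜ := by simpa [T] using hu
    have hv' : v ∈ Sᶜ := by simpa [T] using hv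
    simp only [f, dif_pos hu', dif_pos hv', Option.some_inj]
    exact SimpleGraph.ConnectedComponent.sound
      (SimpleGraph.Adj.reachable (G := G.induce Sᶜ) (u := ⟨u, hu'⟩) (v := ⟨v, hv'⟩) huv)
  have huniv : (G.induce ((Finset.univ : Finset V) : Set V)).IsRP := by
    rw [Finset.coe_univ]
    exact hrp.of_iso G.induceUnivIso.symm
  have hmain := (huniv.card_colours_le hf).2
  have hT : (Finset.univ ∩ T).card = S.ncard := by
    rw [Finset.univ_inter, Set.ncard_eq_toFinset_card']
  have hcol : SimpleGraph.colours T f Finset.univ =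
      (Finset.univ : Finset (G.induce Sᶜ).ConnectedComponent).image some := by
    ext o
    simp only [SimpleGraph.colours, Finset.mem_image, Finset.mem_sdiff, Finset.mem_univ, true_and]
    constructor
    · rintro ⟨v, hv, rfl⟩
      have hv' : v ∈ Sᶜ := by simpa [T] using hv
      exact ⟨(G.induce Sᶜ).connectedComponentMk ⟨v, hv'⟩, by simp only [f, dif_pos hv']⟩
    · rintro ⟨c, rfl⟩
      obtain ⟨⟨v, hv⟩, rfl⟩ := c.exists_rep
      exact ⟨v, by simpa [T] using hv, by simp only [f, dif_pos hv]; rfl⟩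
  have hnum : (SimpleGraph.colours T f Finset.univ).card = (G.induce Sᶜ).numComponents := by
    rw [hcol, Finset.card_image_of_injective _ (Option.some_injective _), Finset.card_univ,
      SimpleGraph.numComponents, Nat.card_eq_fintype_card]
  rw [hT, hnum] at hmain
  exact absurd (hmain hS) (not_lt.mpr hc)
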